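/- Let $\mathcal A=\{l_u,l_d,r_u,r_d,u_l,u_r,d_l,d_r\}$, where a letter $a_b$ stands for a pin of direction $a$ (left, right, up or down) that follows a pin of direction $b$. An infinite pin word is an infinite word $w=w_1w_2\cdots$ over $\mathcal A$ in which the subscript of $w_{i+1}$ is the direction of $w_i$, for all $i\ge 1$. It defines an infinite gridded permutation $\pi_w=\{p_1,p_2,\dots\}$ in the plane gridded by the two axes: $p_1$ lies in the quadrant between the two directions named by $w_1$ (for example in quadrant 1 if $w_1$ is $r_u$ or $u_r$), and for $i\ge 1$ the point $p_{i+1}$ lies outside the rectangular hull of $\{(0,0),p_1,\dots,p_i\}$, on the side given by the direction of $w_{i+1}$, and separates $p_i$ from $\{(0,0),p_1,\dots,p_{i-1}\}$ horizontally or vertically. This determines $\pi_w$ up to the relative order of the coordinates of the points and of the origin. A gridded permutation of length $n$ is a permutation of length $n$ whose plot is divided by one vertical and one horizontal line; two griddings are equal if corresponding cells contain the same points. The pin class $\mathcal C_w$ consists of all finite gridded permutations contained in $\pi_w$, i.e. whose points can be mapped to points of $\pi_w$ so that the horizontal and vertical orders and the cells (quadrants) are preserved. Its growth rate is $\mathrm{gr}(\mathcal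 C_w)=\lim_{n\to\infty}\sqrt[n]{|(\mathcal C_w)_n|}$, if the limit exists, where $(\mathcal C_w)_n$ is the set of members of length $n$. A visit of $w$ to a quadrant $q$ is a finite non-empty contiguous block $w_{i+1}\cdots w_{i+k}$ of $w$ such that $p_{i+1},\dots,p_{i+k}$ lie in $q$, while neither $p_i$ (if $i\ge1$) nor $p_{i+k+1}$ lies in $q$. Blocks at different positions count as different visits. Theorem. Let $w$ be an infinite pin word that contains only finitely many visits (to all quadrants together). Then $\mathrm{gr}(\mathcal C_w)$ exists and equals $\kappa\approx 2.20557$, the largest real root of $z^3-2z^2-1$. -/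

import Mathlib

open Filter Topology

namespace PinClass

/-- The four directions left, right, up, down. -/
inductive Dir
  | l | r | u | d

/-- The unit vector of a direction. -/
def Dir.vec : Dir → ℤ × ℤ
  | .l => (-1, 0)
  | .r => (1, 0)
  | .u => (0, 1)
  | .d => (0, -1)

/-- The eight letters of the memory encoding. The letter `ru`, for example, encodes a right pin
that follows an up pin. -/
inductive Letter
  | lu | ld | ru | rd | ul | ur | dl | dr

/-- The direction of the pin that a letter encodes. -/
def Letter.dir : Letter → Dir
  | .lu => .l
  | .ld => .l
  | .ru => .r
  | .rd => .r
  | .ul => .u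
  | .ur => .u
  | .dl => .d
  | .dr => .d

/-- The direction of the previous pin, as recorded by a letter. -/
def Letter.prev : Letter → Dir
  | .lu => .u
  | .ld => .d
  | .ru => .u
  | .rd => .d
  | .ul => .l
  | .ur => .r
  | .dl => .l
  | .dr => .r

/-- An infinite word over the eight letters is a pin word if each letter correctly records the
direction of the letter before it. Any letter may come first. (The word is indexed from `0`.) -/
def IsPinWord (w : ℕ → Letter) : Prop :=
  ∀ n, (w (n + 1)).prev = (w n).dir

/-- The points of the infinite gridded permutation of a pin word, in the plane gridded by the two
axes. Only the relative order of the coordinates and of `0` matters. The pin number `n` is put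
at distance `2 * n + 4` from the origin in its own direction, which is beyond all earlier pins, and
at distance `2 * n + 1` in the direction of the previous pin, which is short of the previous pin
(at `2 * n + 2`) and beyond the origin and all other earlier pins. The pin number `0` is in the
quadrant that its letter names. See `point_zero` and `point_succ`. -/
def point (w : ℕ → Letter) (n : ℕ) : ℤ × ℤ :=
  (2 * (n : ℤ) + 4) • (w n).dir.vec + (2 * (n : ℤ) + 1) • (w n).prev.vec

/-- The coordinate of a point measured in a given direction. -/
def coord (e : Dir) (p : ℤ × ℤ) : ℤ :=
  e.vec.1 * p.1 + e.vec.2 * p.2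

theorem coord_dir (w : ℕ → Letter) (n : ℕ) : coord (w n).dir (point w n) = 2 * n + 4 := by
  unfold coord point
  cases w n <;> simp [Letter.dir, Letter.prev, Dir.vec]

theorem coord_prev (w : ℕ → Letter) (n : ℕ) : coord (w n).prev (point w n) = 2 * n + 1 := by
  unfold coord point
  cases w n <;> simp [Letter.dir, Letter.prev, Dir.vec]

theorem coord_le (w : ℕ → Letter) (n : ℕ) (e : Dir) : coord e (point w n) ≤ 2 * n + 4 := by
  unfold coord point
  cases w n <;> cases e <;> simp [Letter.dir, Letter.prev, Dir.vec] <;> omega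

/-- The first pin lies in the quadrant between the two directions of its letter. -/
theorem point_zero (w : ℕ → Letter) :
    0 < coord (w 0).dir (point w 0) ∧ 0 < coord (w 0).prev (point w 0) := by
  rw [coord_dir, coord_prev]
  simp

/-- Every later pin is a proper pin of the prescribed direction for the origin and the earlier
pins: it lies outside their rectangular hull, on the side prescribed by its letter, and it
separates the previous pin from the origin and all other earlier pins. -/
theorem point_succ (w : ℕ → Letter) (hw : IsPinWord w) (n : ℕ) :
    (0 < coord (w (n + 1)).dir (point w (n + 1)) ∧
      ∀ i ≤ n, coord (w (n + 1)).dir (point w i) < coord (w (n + 1)).dir (point w (n + 1))) ∧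
    (0 < coord (w n).dir (point w (n + 1)) ∧
      (∀ i < n, coord (w n).dir (point w i) < coord (w n).dir (point w (n + 1))) ∧
      coord (w n).dir (point w (n + 1)) < coord (w n).dir (point w n)) := by
  have h1 := coord_dir w (n + 1)
  have h2 := coord_prev w (n + 1)
  have h3 := coord_dir w n
  rw [hw n] at h2
  push_cast at h1 h2
  refine ⟨⟨by omega, fun i hi => ?_⟩, by omega, fun i hi => ?_, by omega⟩
  · have := coord_le w i (w (n + 1)).dir
    omega
  · have := coord_le w i (w n).dir
    omega

/-- The number of the quadrant, in the usual numbering, of a point that is on neither axis. -/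
def quadrant (p : ℤ × ℤ) : ℕ :=
  if 0 < p.1 then (if 0 < p.2 then 1 else 4) else (if 0 < p.2 then 2 else 3)

/-- The `k` letters of `w` from number `i` on are a visit to the quadrant `q`: they are at least
one, their points are in `q`, and neither the point before them (if there is one) nor the point
after them is in `q`. -/
def IsVisit (w : ℕ → Letter) (q i k : ℕ) : Prop :=
  0 < k ∧
  (∀ j, i ≤ j → j < i + k → quadrant (point w j) = q) ∧
  (∀ j, j + 1 = i → quadrant (point w j) ≠ q) ∧
  quadrant (point w (i + k)) ≠ q

/-- The visits of `w` to all quadrants, as pairs (start, number of letters). -/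
def visits (w : ℕ → Letter) : Set (ℕ × ℕ) :=
  {v | ∃ q, IsVisit w q v.1 v.2}

/-- A permutation of length `n` gridded by one vertical and one horizontal line. Two griddings
are the same if the cells contain the same points, so a line is given by the number of points to
the left of it, respectively below it. -/
@[ext]
structure GriddedPerm (n : ℕ) where
  perm : Equiv.Perm (Fin n)
  left : Fin (n + 1)
  below : Fin (n + 1)

instance (n : ℕ) : Finite (GriddedPerm n) :=
  Finite.of_injective (fun σ : GriddedPerm n => (σ.perm, σ.left, σ.below)) (by
    intro σ τ h
    simp only [Prod.mk.injEq] at h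
    exact GriddedPerm.ext h.1 h.2.1 h.2.2)

/-- `σ` is contained, as a gridded permutation, in the infinite gridded permutation of `w`: the
points `(i, σ i)` of its plot can be mapped to points of `w` so that the horizontal and the
vertical order are kept and every point stays in its cell. -/
def Contained {n : ℕ} (σ : GriddedPerm n) (w : ℕ → Letter) : Prop :=
  ∃ f : Fin n → ℕ,
    (∀ i j, i < j ↔ (point w (f i)).1 < (point w (f j)).1) ∧
    (∀ i j, σ.perm i < σ.perm j ↔ (point w (f i)).2 < (point w (f j)).2) ∧
    (∀ i : Fin n, (i : ℕ) < σ.left ↔ (point w (f i)).1 < 0) ∧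
    (∀ i : Fin n, (σ.perm i : ℕ) < σ.below ↔ (point w (f i)).2 < 0)

/-- The members of length `n` of the pin class of `w`. -/
def pinClass (w : ℕ → Letter) (n : ℕ) : Set (GriddedPerm n) :=
  {σ | Contained σ w}

/-- The sequence `s` has growth rate `g`: the `n`-th roots of its terms converge to `g`. -/
def HasGrowthRate (s : ℕ → ℕ) (g : ℝ) : Prop :=
  Tendsto (fun n : ℕ => (s n : ℝ) ^ (1 / (n : ℝ))) atTop (𝓝 g)

end PinClass

/-! Every change of quadrant that is followed by a later change starts a new visit, so `w`
eventually stays in one quadrant. From there on its pins alternate between two directions: up to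
reflections the tail is an increasing oscillation, in which two points form an inversion exactly
when their indices are consecutive, and the parities of the two indices tell which point is the
further right.

Upper bound. Among the embeddings of a member of the class, take one with least sum of indices. Any
gap that can be closed without changing the relative order would reduce the sum. So beyond a bounded
initial part only the steps 1, 2, 3 occur, and each 3 is followed by 1, 1
(`IsOscillation.exists_stepRestricted`). The set of indices determines the member.

Lower bound. Among such sets inside the tail with a fixed least element, different sets give
different members, because the inversions and their parities determine the set
(`eq_of_stepRestricted`).

Either way, sets built from the blocks 1, 2 and 311 are counted. Their numbers grow like the
recurrence $a_n=2a_{n-1}+a_{n-3}$, with characteristic equation $z^3=2z^2+1$. -/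

namespace PinClass

/-! ### Upper bound for the number of step-restricted sets -/

/-- Above `K`, consecutive elements of `A` differ by at most `3`, and a difference of `3` is
followed by two differences of `1`. -/
def StepRestricted (K : ℕ) (A : Finset ℕ) : Prop :=
  ∀ b ∈ A, K ≤ b → (b - 1 ∈ A ∨ b - 2 ∈ A ∨ b - 3 ∈ A) ∧
    (b - 1 ∉ A → b - 2 ∉ A → b + 1 ∈ A ∧ b + 2 ∈ A)

/-- The step-restricted sets with `n` elements. -/
def stepFamily (K n : ℕ) : Set (Finset ℕ) :=
  {A | A.card = n ∧ StepRestricted K A}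

/-- Append an element at distance `d` above the largest one. -/
def appendStep (d : ℕ) (A : Finset ℕ) : Finset ℕ :=
  insert (A.sup id + d) A

/-- Append three elements with steps `3`, `1`, `1`. -/
def appendTriple (A : Finset ℕ) : Finset ℕ :=
  insert (A.sup id + 5) (insert (A.sup id + 4) (insert (A.sup id + 3) A))

theorem sup_id_eq {A : Finset ℕ} {m : ℕ} (hm : m ∈ A) (h : ∀ a ∈ A, a ≤ m) : A.sup id = m :=
  le_antisymm (Finset.sup_le h) (Finset.le_sup (f := id) hm)

theorem sup_id_mem {A : Finset ℕ} (h : A.Nonempty) : A.sup id ∈ A := by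
  obtain ⟨a, ha, he⟩ := Finset.exists_mem_eq_sup A h id
  rw [he]; exact ha

theorem le_sup_id {A : Finset ℕ} {a : ℕ} (ha : a ∈ A) : a ≤ A.sup id :=
  Finset.le_sup (f := id) ha

/-- Strip the last block of steps: 1, 2 or 311. The sets below `K`, where nothing is restricted,
contribute only a constant. -/
theorem stepFamily_subset {K n : ℕ} (hK : 5 ≤ K) :
    stepFamily K n ⊆ ((Finset.range K).powerset : Set (Finset ℕ)) ∪
      (appendStep 1 '' stepFamily K (n - 1) ∪ appendStep 2 '' stepFamily K (n - 1) ∪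
        appendTriple '' stepFamily K (n - 3)) := by
  rintro A ⟨hc, hA⟩
  by_cases hsub : A ⊆ Finset.range K
  · exact Or.inl (Finset.mem_coe.2 (Finset.mem_powerset.2 hsub))
  right
  obtain ⟨b, hbA, hbK⟩ := Finset.not_subset.1 hsub
  have hne : A.Nonempty := ⟨b, hbA⟩
  obtain ⟨m, hm⟩ : ∃ m, m = A.sup id := ⟨_, rfl⟩
  have hmA : m ∈ A := hm ▸ sup_id_mem hne
  have hle : ∀ a ∈ A, a ≤ m := fun a ha => hm ▸ le_sup_id ha
  have hmK : K ≤ m := by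
    have := hle b hbA
    simp at hbK; omega
  obtain ⟨h1, h2⟩ := hA m hmA hmK
  have hm1 : m + 1 ∉ A := fun h => by have := hle _ h; omega
  -- The last three steps are 3, 1, 1. This is the only case in which deleting `m` alone would leave
  -- a step 3 without its two steps 1.
  by_cases htri : m - 1 ∈ A ∧ m - 2 ∈ A ∧ K ≤ m - 2 ∧ m - 3 ∉ A ∧ m - 4 ∉ A
  · obtain ⟨t1, t2, t3, t4, t5⟩ := htri
    right
    have h5 : m - 5 ∈ A := by
      rcases (hA _ t2 t3).1 with h | h | h
      · rw [show m - 2 - 1 = m - 3 by omega] at h; exact absurd h t4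
      · rw [show m - 2 - 2 = m - 4 by omega] at h; exact absurd h t5
      · rwa [show m - 2 - 3 = m - 5 by omega] at h
    have hmem : ∀ a, a ∈ A \ {m, m - 1, m - 2} ↔ a ∈ A ∧ a ≤ m - 5 := by
      intro a
      simp only [Finset.mem_sdiff, Finset.mem_insert, Finset.mem_singleton]
      constructor
      · rintro ⟨ha, hn⟩
        refine ⟨ha, ?_⟩
        have := hle a ha
        have : a ≠ m - 3 := fun h => t4 (h ▸ ha)
        have : a ≠ m - 4 := fun h => t5 (h ▸ ha)
        omega
      · rintro ⟨ha, hn⟩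
        exact ⟨ha, by omega⟩
    have hs : (A \ {m, m - 1, m - 2}).sup id = m - 5 :=
      sup_id_eq ((hmem _).2 ⟨h5, le_rfl⟩) fun a ha => ((hmem a).1 ha).2
    refine ⟨A \ {m, m - 1, m - 2}, ⟨?_, ?_⟩, ?_⟩
    · rw [Finset.card_sdiff_of_subset, hc]
      · rw [Finset.card_insert_of_notMem, Finset.card_insert_of_notMem, Finset.card_singleton]
        · simp; omega
        · simp; omega
      · intro a ha
        simp only [Finset.mem_insert, Finset.mem_singleton] at ha
        rcases ha with rfl | rfl | rfl <;> assumption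
    · intro c hcA hcK
      simp only [hmem] at hcA ⊢
      obtain ⟨g1, g2⟩ := hA c hcA.1 hcK
      refine ⟨?_, fun n1 n2 => ?_⟩
      · rcases g1 with g | g | g
        · exact Or.inl ⟨g, by omega⟩
        · exact Or.inr (Or.inl ⟨g, by omega⟩)
        · exact Or.inr (Or.inr ⟨g, by omega⟩)
      · obtain ⟨e1, e2⟩ := g2 (fun h => n1 ⟨h, by omega⟩) (fun h => n2 ⟨h, by omega⟩)
        have : c + 1 ≠ m - 4 := fun h => t5 (h ▸ e1)
        have : c + 2 ≠ m - 4 := fun h => t5 (h ▸ e2)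
        exact ⟨⟨e1, by omega⟩, ⟨e2, by omega⟩⟩
    · ext a
      rw [appendTriple, hs]
      simp only [Finset.mem_insert, hmem]
      constructor
      · rintro (rfl | rfl | rfl | h)
        · rwa [show m - 5 + 5 = m by omega]
        · rwa [show m - 5 + 4 = m - 1 by omega]
        · rwa [show m - 5 + 3 = m - 2 by omega]
        · exact h.1
      · intro ha
        have := hle a ha
        have : a ≠ m - 3 := fun h => t4 (h ▸ ha)
        have : a ≠ m - 4 := fun h => t5 (h ▸ ha)
        by_cases h : a ≤ m - 5
        · exact Or.inr (Or.inr (Or.inr ⟨ha, h⟩))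
        · omega
  · left
    have herase : A.erase m ∈ stepFamily K (n - 1) := by
      refine ⟨by rw [Finset.card_erase_of_mem hmA, hc], ?_⟩
      intro c hcA hcK
      simp only [Finset.mem_erase] at hcA ⊢
      obtain ⟨g1, g2⟩ := hA c hcA.2 hcK
      have hcm := hle c hcA.2
      refine ⟨?_, fun n1 n2 => ?_⟩
      · rcases g1 with g | g | g
        · exact Or.inl ⟨by omega, g⟩
        · exact Or.inr (Or.inl ⟨by omega, g⟩)
        · exact Or.inr (Or.inr ⟨by omega, g⟩)
      · have n1' : c - 1 ∉ A := fun h => n1 ⟨by omega, h⟩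
        have n2' : c - 2 ∉ A := fun h => n2 ⟨by omega, h⟩
        obtain ⟨e1, e2⟩ := g2 n1' n2'
        have := hle _ e2
        refine ⟨⟨by omega, e1⟩, ⟨fun h => htri ?_, e2⟩⟩
        rw [show m - 1 = c + 1 by omega, show m - 2 = c by omega, show m - 3 = c - 1 by omega,
          show m - 4 = c - 2 by omega]
        exact ⟨e1, hcA.2, hcK, n1', n2'⟩
    by_cases t1 : m - 1 ∈ A
    · left
      refine ⟨A.erase m, herase, ?_⟩
      have : (A.erase m).sup id = m - 1 := by
        refine sup_id_eq (by simp only [Finset.mem_erase]; exact ⟨by omega, t1⟩) fun a ha => ?_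
        simp only [Finset.mem_erase] at ha
        have := hle a ha.2
        omega
      rw [appendStep, this, show m - 1 + 1 = m by omega, Finset.insert_erase hmA]
    · right
      -- A step 3 up to the maximum `m` would require `m + 1` in `A`.
      have t2 : m - 2 ∈ A := by
        by_contra t2
        exact hm1 (h2 t1 t2).1
      refine ⟨A.erase m, herase, ?_⟩
      have : (A.erase m).sup id = m - 2 := by
        refine sup_id_eq (by simp only [Finset.mem_erase]; exact ⟨by omega, t2⟩) fun a ha => ?_
        simp only [Finset.mem_erase] at ha
        have := hle a ha.2
        have : a ≠ m - 1 := fun h => t1 (h ▸ ha.2)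
        omega
      rw [appendStep, this, show m - 2 + 2 = m by omega, Finset.insert_erase hmA]

theorem stepFamily_zero_subset (K : ℕ) : stepFamily K 0 ⊆ {∅} := by
  rintro A ⟨hc, -⟩
  simpa using hc

theorem stepFamily_finite {K : ℕ} (hK : 5 ≤ K) (n : ℕ) : (stepFamily K n).Finite := by
  induction n using Nat.strong_induction_on with
  | _ n ih =>
    rcases Nat.eq_zero_or_pos n with rfl | hn
    · exact (Set.finite_singleton _).subset (stepFamily_zero_subset K)
    · have a := ih (n - 1) (by omega)
      have b := ih (n - 3) (by omega)
      exact (((Finset.finite_toSet _).union (((a.image _).union (a.image _)).union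
        (b.image _)))).subset (stepFamily_subset hK)

theorem ncard_stepFamily_le {K n : ℕ} (hK : 5 ≤ K) :
    (stepFamily K n).ncard ≤
      2 ^ K + 2 * (stepFamily K (n - 1)).ncard + (stepFamily K (n - 3)).ncard := by
  have a := stepFamily_finite hK (n - 1)
  have b := stepFamily_finite hK (n - 3)
  refine (Set.ncard_le_ncard (stepFamily_subset hK) ((Finset.finite_toSet _).union
    (((a.image _).union (a.image _)).union (b.image _)))).trans ?_
  refine (Set.ncard_union_le _ _).trans ?_
  have h0 : ((Finset.range K).powerset : Set (Finset ℕ)).ncard = 2 ^ K := by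
    rw [Set.ncard_coe_finset, Finset.card_powerset, Finset.card_range]
  have h1 := Set.ncard_union_le
    (appendStep 1 '' stepFamily K (n - 1) ∪ appendStep 2 '' stepFamily K (n - 1))
    (appendTriple '' stepFamily K (n - 3))
  have h2 := Set.ncard_union_le
    (appendStep 1 '' stepFamily K (n - 1)) (appendStep 2 '' stepFamily K (n - 1))
  have h3 := Set.ncard_image_le (f := appendStep 1) a
  have h4 := Set.ncard_image_le (f := appendStep 2) a
  have h5 := Set.ncard_image_le (f := appendTriple) b
  omega

theorem ncard_stepFamily_le_pow {K : ℕ} (hK : 5 ≤ K) {κ : ℝ} (hκ : 2 ≤ κ)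
    (hroot : κ ^ 3 = 2 * κ ^ 2 + 1) (n : ℕ) :
    ((stepFamily K n).ncard : ℝ) ≤ 11 * 2 ^ K * κ ^ n := by
  -- Adding half of the constant `2 ^ K` makes the recurrence homogeneous: with $D=2^K$, $D + D/2 =
  -- 2\cdot D/2 + D/2$. The factor 11 is large enough for the three initial values.
  suffices h : ((stepFamily K n).ncard : ℝ) + 2 ^ K / 2 ≤ 11 * 2 ^ K * κ ^ n by
    have : (0 : ℝ) < 2 ^ K := by positivity
    linarith
  have hD : (1 : ℝ) ≤ 2 ^ K := one_le_pow₀ (by norm_num)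
  have hrec : ∀ n, ((stepFamily K n).ncard : ℝ) ≤
      2 ^ K + 2 * (stepFamily K (n - 1)).ncard + (stepFamily K (n - 3)).ncard := fun n => by
    exact_mod_cast ncard_stepFamily_le hK
  have h0 : ((stepFamily K 0).ncard : ℝ) ≤ 1 := by
    have := Set.ncard_le_ncard (stepFamily_zero_subset K) (Set.finite_singleton _)
    rw [Set.ncard_singleton] at this
    exact_mod_cast this
  have h1 := hrec 1
  have h2 := hrec 2
  norm_num at h1 h2
  induction n using Nat.strong_induction_on with
  | _ n ih =>
    match n with
    | 0 => norm_num; linarith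
    | 1 => nlinarith
    | 2 =>
      have h4 : (4 : ℝ) ≤ κ ^ 2 := by nlinarith
      nlinarith [mul_le_mul_of_nonneg_left h4 (zero_le_one.trans hD)]
    | k + 3 =>
      have a := ih (k + 2) (by omega)
      have b := ih k (by omega)
      have c := hrec (k + 3)
      rw [show k + 3 - 1 = k + 2 by omega, show k + 3 - 3 = k by omega] at c
      have e : κ ^ (k + 3) = 2 * κ ^ (k + 2) + κ ^ k := by
        rw [pow_add, hroot]; ring
      rw [e]
      linarith

/-! ### Lower bound for the number of step-restricted sets -/

/-- The step-restricted sets with `n` elements and smallest element `s`. -/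
def stepFamilyFrom (s n : ℕ) : Set (Finset ℕ) :=
  {A | A ∈ stepFamily (s + 1) n ∧ s ∈ A ∧ ∀ a ∈ A, s ≤ a}

theorem appendStep_mem {s n d : ℕ} (hd : 1 ≤ d) (hd2 : d ≤ 2) {A : Finset ℕ}
    (hA : A ∈ stepFamilyFrom s n) : appendStep d A ∈ stepFamilyFrom s (n + 1) := by
  obtain ⟨⟨hc, hr⟩, hs, hle⟩ := hA
  have hm := sup_id_mem ⟨s, hs⟩
  have hmax : ∀ a ∈ A, a ≤ A.sup id := fun a => le_sup_id
  unfold appendStep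
  generalize A.sup id = m at *
  have hsm := hle m hm
  refine ⟨⟨?_, ?_⟩, by simp [hs], ?_⟩
  · rw [Finset.card_insert_of_notMem, hc]
    intro h; have := hmax _ h; omega
  · intro b hb hbs
    simp only [Finset.mem_insert] at hb ⊢
    rcases hb with rfl | hb
    · have : m + d - 1 = m ∨ m + d - 2 = m := by omega
      rcases this with h | h <;> rw [h] <;> simp [hm]
    · obtain ⟨g1, g2⟩ := hr b hb hbs
      have := hmax b hb
      refine ⟨by tauto, fun n1 n2 => ?_⟩
      have := g2 (by tauto) (by tauto)
      tauto
  · intro a ha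
    simp only [Finset.mem_insert] at ha
    rcases ha with rfl | ha
    · omega
    · exact hle a ha

theorem appendTriple_mem {s n : ℕ} {A : Finset ℕ}
    (hA : A ∈ stepFamilyFrom s n) : appendTriple A ∈ stepFamilyFrom s (n + 3) := by
  obtain ⟨⟨hc, hr⟩, hs, hle⟩ := hA
  have hm := sup_id_mem ⟨s, hs⟩
  have hmax : ∀ a ∈ A, a ≤ A.sup id := fun a => le_sup_id
  unfold appendTriple
  generalize A.sup id = m at *
  have hsm := hle m hm
  have hn : ∀ k, m < k → k ∉ A := fun k hk h => by have := hmax _ h; omega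
  refine ⟨⟨?_, ?_⟩, by simp [hs], ?_⟩
  · rw [Finset.card_insert_of_notMem, Finset.card_insert_of_notMem,
      Finset.card_insert_of_notMem, hc]
    · exact hn _ (by omega)
    · simp [hn (m + 4) (by omega)]
    · simp [hn (m + 5) (by omega)]
  · intro b hb hbs
    simp only [Finset.mem_insert] at hb ⊢
    rcases hb with rfl | rfl | rfl | hb
    · rw [show m + 5 - 1 = m + 4 by omega]; simp
    · rw [show m + 4 - 1 = m + 3 by omega]; simp
    · rw [show m + 3 - 3 = m by omega]; simp [hm]
    · obtain ⟨g1, g2⟩ := hr b hb hbs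
      refine ⟨by tauto, fun n1 n2 => ?_⟩
      have := g2 (by tauto) (by tauto)
      tauto
  · intro a ha
    simp only [Finset.mem_insert] at ha
    rcases ha with rfl | rfl | rfl | ha
    · omega
    · omega
    · omega
    · exact hle a ha

theorem sup_appendStep {d : ℕ} {A : Finset ℕ} : (appendStep d A).sup id = A.sup id + d :=
  sup_id_eq (by simp [appendStep]) fun a ha => by
    simp only [appendStep, Finset.mem_insert] at ha
    rcases ha with rfl | ha
    · rfl
    · exact (le_sup_id ha).trans (Nat.le_add_right _ _)

theorem sup_appendTriple {A : Finset ℕ} : (appendTriple A).sup id = A.sup id + 5 :=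
  sup_id_eq (by simp [appendTriple]) fun a ha => by
    simp only [appendTriple, Finset.mem_insert] at ha
    rcases ha with rfl | rfl | rfl | ha
    · omega
    · omega
    · omega
    · exact (le_sup_id ha).trans (Nat.le_add_right _ _)

theorem mem_iff_mem_appendStep {d : ℕ} {A : Finset ℕ} (hd : 1 ≤ d) (a : ℕ) :
    a ∈ A ↔ a ∈ appendStep d A ∧ a ≤ (appendStep d A).sup id - d := by
  rw [sup_appendStep]
  simp only [appendStep, Finset.mem_insert]
  constructor
  · intro h
    have := le_sup_id h
    exact ⟨Or.inr h, by omega⟩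
  · rintro ⟨rfl | h, h2⟩
    · omega
    · exact h

theorem mem_iff_mem_appendTriple {A : Finset ℕ} (a : ℕ) :
    a ∈ A ↔ a ∈ appendTriple A ∧ a ≤ (appendTriple A).sup id - 5 := by
  rw [sup_appendTriple]
  simp only [appendTriple, Finset.mem_insert]
  constructor
  · intro h
    have := le_sup_id h
    exact ⟨Or.inr (Or.inr (Or.inr h)), by omega⟩
  · rintro ⟨rfl | rfl | rfl | h, h2⟩
    · omega
    · omega
    · omega
    · exact h

theorem appendStep_injective {d : ℕ} (hd : 1 ≤ d) : Function.Injective (appendStep d) := by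
  intro A B h
  ext a
  rw [mem_iff_mem_appendStep hd, h, ← mem_iff_mem_appendStep hd]

theorem appendTriple_injective : Function.Injective appendTriple := by
  intro A B h
  ext a
  rw [mem_iff_mem_appendTriple, h, ← mem_iff_mem_appendTriple]

theorem appendStep_one_ne_two {A B : Finset ℕ} (hA : A.Nonempty) :
    appendStep 1 A ≠ appendStep 2 B := by
  intro h
  have hs : (appendStep 1 A).sup id = (appendStep 2 B).sup id := by rw [h]
  rw [sup_appendStep, sup_appendStep] at hs
  have hm : A.sup id ∈ appendStep 2 B := by
    rw [← h]; simp [appendStep, sup_id_mem hA]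
  simp only [appendStep, Finset.mem_insert] at hm
  rcases hm with hm | hm
  · omega
  · have := le_sup_id hm
    omega

theorem appendStep_two_ne_triple {A B : Finset ℕ} :
    appendStep 2 A ≠ appendTriple B := by
  intro h
  have hs : (appendStep 2 A).sup id = (appendTriple B).sup id := by rw [h]
  rw [sup_appendStep, sup_appendTriple] at hs
  have hm : B.sup id + 4 ∈ appendStep 2 A := by
    rw [h]; simp [appendTriple]
  simp only [appendStep, Finset.mem_insert] at hm
  rcases hm with hm | hm
  · omega
  · have := le_sup_id hm
    omega

/-- Otherwise `A` would end with a step 3 followed by a single step 1, which the restriction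
forbids. -/
theorem appendStep_one_ne_triple {s n : ℕ} {A B : Finset ℕ} (hA : A ∈ stepFamilyFrom s n)
    (hBs : s ∈ B) :
    appendStep 1 A ≠ appendTriple B := by
  intro h
  have hs : (appendStep 1 A).sup id = (appendTriple B).sup id := by rw [h]
  rw [sup_appendStep, sup_appendTriple] at hs
  have hmem : ∀ a, a ∈ A ↔ a = B.sup id + 4 ∨ a = B.sup id + 3 ∨ a ∈ B := by
    intro a
    rw [mem_iff_mem_appendStep (d := 1) le_rfl, h, sup_appendTriple]
    simp only [appendTriple, Finset.mem_insert]
    constructor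
    · rintro ⟨rfl | h, h2⟩
      · omega
      · exact h
    · intro h
      refine ⟨Or.inr h, ?_⟩
      rcases h with rfl | rfl | h
      · omega
      · omega
      · have := le_sup_id h
        omega
  have hsB := le_sup_id hBs
  have hlt : ∀ b, B.sup id < b → b ∉ B := fun b hb h => by
    have := le_sup_id h
    omega
  have := (hA.1.2 (B.sup id + 3) ((hmem _).2 (by simp)) (by omega)).2
  simp only [hmem] at this
  have h5 := (this ?_ ?_).2
  · rcases h5 with h5 | h5 | h5
    · omega
    · omega
    · exact hlt _ (by omega) h5
  · rintro (h5 | h5 | h5)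
    · omega
    · omega
    · exact hlt _ (by omega) h5
  · rintro (h5 | h5 | h5)
    · omega
    · omega
    · exact hlt _ (by omega) h5

theorem stepFamilyFrom_finite {s : ℕ} (hs : 4 ≤ s) (n : ℕ) : (stepFamilyFrom s n).Finite :=
  (stepFamily_finite (by omega : 5 ≤ s + 1) n).subset fun _ h => h.1

theorem le_ncard_stepFamilyFrom {s : ℕ} (hs : 4 ≤ s) (n : ℕ) :
    2 * (stepFamilyFrom s n).ncard + (stepFamilyFrom s (n - 2)).ncard ≤
      (stepFamilyFrom s (n + 1)).ncard := by
  have a := stepFamilyFrom_finite hs n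
  have b := stepFamilyFrom_finite hs (n - 2)
  have hsub : appendStep 1 '' stepFamilyFrom s n ∪ appendStep 2 '' stepFamilyFrom s n ∪
      appendTriple '' stepFamilyFrom s (n - 2) ⊆ stepFamilyFrom s (n + 1) := by
    rintro _ ((⟨A, hA, rfl⟩ | ⟨A, hA, rfl⟩) | ⟨A, hA, rfl⟩)
    · exact appendStep_mem le_rfl (by norm_num) hA
    · exact appendStep_mem (by norm_num) le_rfl hA
    -- The sets contain `s`, so the truncated case `n - 2 = 0` contributes nothing.
    · have hpos : 0 < n - 2 := by
        rw [← hA.1.1]; exact Finset.card_pos.2 ⟨s, hA.2.1⟩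
      have := appendTriple_mem hA
      rwa [show n - 2 + 3 = n + 1 by omega] at this
  have h := Set.ncard_le_ncard hsub (stepFamilyFrom_finite hs _)
  rw [Set.ncard_union_eq _ ((a.image _).union (a.image _)) (b.image _),
    Set.ncard_union_eq _ (a.image _) (a.image _),
    Set.ncard_image_of_injective _ (appendStep_injective le_rfl),
    Set.ncard_image_of_injective _ (appendStep_injective (by norm_num)),
    Set.ncard_image_of_injective _ appendTriple_injective] at h
  · omega
  · rw [Set.disjoint_left]
    rintro _ ⟨A, hA, rfl⟩ ⟨B, hB, h⟩
    exact appendStep_one_ne_two ⟨s, hA.2.1⟩ h.symm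
  · rw [Set.disjoint_left]
    rintro _ (⟨A, hA, rfl⟩ | ⟨A, hA, rfl⟩) ⟨B, hB, h⟩
    · exact appendStep_one_ne_triple hA hB.2.1 h.symm
    · exact appendStep_two_ne_triple h.symm

theorem pow_le_ncard_stepFamilyFrom {s : ℕ} (hs : 4 ≤ s) {κ : ℝ} (hκ : 2 ≤ κ)
    (hroot : κ ^ 3 = 2 * κ ^ 2 + 1) (n : ℕ) :
    κ ^ (n + 1) ≤ κ ^ 3 * (stepFamilyFrom s (n + 1)).ncard := by
  have hrec : ∀ n, 2 * ((stepFamilyFrom s n).ncard : ℝ) + (stepFamilyFrom s (n - 2)).ncard ≤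
      (stepFamilyFrom s (n + 1)).ncard := fun n => by
    exact_mod_cast le_ncard_stepFamilyFrom hs n
  have h1 : (1 : ℝ) ≤ (stepFamilyFrom s 1).ncard := by
    have : 0 < (stepFamilyFrom s 1).ncard := by
      rw [Set.ncard_pos (stepFamilyFrom_finite hs 1)]
      refine ⟨{s}, ⟨by simp, ?_⟩, by simp, by simp⟩
      intro b hb hbs
      simp at hb
      omega
    exact_mod_cast this
  have h2 := hrec 1
  have h3 := hrec 2
  norm_num at h2 h3
  have p0 : (0 : ℝ) ≤ (stepFamilyFrom s 0).ncard := by positivity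
  induction n using Nat.strong_induction_on with
  | _ n ih =>
    have hk : κ ^ 2 ≤ κ ^ 3 := pow_le_pow_right₀ (by linarith) (by norm_num)
    have hk1 : κ ^ 1 ≤ κ ^ 3 := pow_le_pow_right₀ (by linarith) (by norm_num)
    have hk3 : 0 < κ ^ 3 := by positivity
    match n with
    | 0 =>
      norm_num at hk1 ⊢
      nlinarith
    | 1 =>
      norm_num
      nlinarith
    | 2 =>
      norm_num
      nlinarith
    | k + 3 =>
      have a := ih (k + 2) (by omega)
      have b := ih k (by omega)
      have c := hrec (k + 3)
      rw [show k + 3 - 2 = k + 1 by omega] at c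
      have e : κ ^ (k + 3 + 1) = 2 * κ ^ (k + 2 + 1) + κ ^ (k + 1) := by
        rw [show k + 3 + 1 = k + 1 + 3 by ring, pow_add, hroot]; ring
      rw [e]
      have := mul_le_mul_of_nonneg_left c hk3.le
      linarith

/-! ### The root and the growth rate -/

theorem exists_greatest_root :
    ∃ κ : ℝ, IsGreatest {z : ℝ | z ^ 3 - 2 * z ^ 2 - 1 = 0} κ ∧ |κ - 2.20557| < 0.000005 := by
  have hc : ContinuousOn (fun z : ℝ => z ^ 3 - 2 * z ^ 2 - 1) (Set.Icc 2.205566 2.205574) := by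
    fun_prop
  obtain ⟨κ, ⟨h1, h2⟩, h⟩ := intermediate_value_Icc (by norm_num) hc
    (show (0 : ℝ) ∈ _ from ⟨by norm_num, by norm_num⟩)
  refine ⟨κ, ⟨h, fun z hz => ?_⟩, by rw [abs_lt]; constructor <;> linarith⟩
  simp only [Set.mem_ofPred_eq] at hz h
  by_contra! hlt
  -- This product is the difference of the polynomial's values at `z` and `κ`; both exceed 2.
  have : 0 < (z - κ) * (z * (z + κ - 2) + κ * (κ - 2)) := by
    apply mul_pos (by linarith)
    have : 0 < z * (z + κ - 2) := mul_pos (by linarith) (by linarith)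
    have : 0 < κ * (κ - 2) := mul_pos (by linarith) (by linarith)
    linarith
  nlinarith

theorem hasGrowthRate_of_le_of_le {s : ℕ → ℕ} {κ c C : ℝ} (hκ : 0 < κ) (hc : 0 < c) (hC : 0 < C)
    (hl : ∀ n, 0 < n → c * κ ^ n ≤ s n) (hu : ∀ n, 0 < n → (s n : ℝ) ≤ C * κ ^ n) :
    HasGrowthRate s κ := by
  have key : ∀ a : ℝ, 0 < a →
      Tendsto (fun n : ℕ => (a * κ ^ n) ^ (1 / (n : ℝ))) atTop (𝓝 κ) := by
    intro a ha
    have h1 : Tendsto (fun n : ℕ => a ^ (1 / (n : ℝ)) * κ) atTop (𝓝 (a ^ (0 : ℝ) * κ)) :=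
      (((Real.continuous_const_rpow ha.ne').tendsto 0).comp
        tendsto_one_div_atTop_nhds_zero_nat).mul_const κ
    rw [Real.rpow_zero, one_mul] at h1
    refine h1.congr' ?_
    filter_upwards [eventually_gt_atTop 0] with n hn
    rw [Real.mul_rpow ha.le (by positivity), ← Real.rpow_natCast, ← Real.rpow_mul hκ.le,
      mul_one_div_cancel (by positivity), Real.rpow_one]
  refine tendsto_of_tendsto_of_tendsto_of_le_of_le' (key c hc) (key C hC) ?_ ?_
  · filter_upwards [eventually_gt_atTop 0] with n hn
    exact Real.rpow_le_rpow (by positivity) (hl n hn) (by positivity)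
  · filter_upwards [eventually_gt_atTop 0] with n hn
    exact Real.rpow_le_rpow (by positivity) (hu n hn) (by positivity)

/-! ### The tail of the word is an oscillation -/

/-- From `M` on, `w` is an increasing oscillation, up to reflections in the axes with the signs
`sx` and `sy`: the pins number `n` with `n % 2 = p` are horizontal and the others vertical. -/
structure IsOscillation (w : ℕ → Letter) (M p : ℕ) (sx sy : ℤ) : Prop where
  p_lt : p < 2
  sx_eq : sx = 1 ∨ sx = -1
  sy_eq : sy = 1 ∨ sy = -1
  horizontal : ∀ n, M ≤ n → n % 2 = p →
    sx * (point w n).1 = 2 * n + 4 ∧ sy * (point w n).2 = 2 * n + 1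
  vertical : ∀ n, M ≤ n → n % 2 ≠ p →
    sx * (point w n).1 = 2 * n + 1 ∧ sy * (point w n).2 = 2 * n + 4

/-- `f` and `g` select points in the same relative order. -/
def SameOrder (w : ℕ → Letter) {ι : Type*} (f g : ι → ℕ) : Prop :=
  (∀ i j, (point w (f i)).1 < (point w (f j)).1 ↔ (point w (g i)).1 < (point w (g j)).1) ∧
    ∀ i j, (point w (f i)).2 < (point w (f j)).2 ↔ (point w (g i)).2 < (point w (g j)).2

theorem sign_lt_iff {ι : Type*} {a b : ι → ℤ} {s : ℤ} (hs : s = 1 ∨ s = -1) :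
    (∀ i j, a i < a j ↔ b i < b j) ↔ ∀ i j, s * a i < s * a j ↔ s * b i < s * b j := by
  rcases hs with rfl | rfl
  · simp
  · simp only [neg_mul, one_mul, neg_lt_neg_iff]
    exact forall_comm

theorem eventually_quadrant_const {w : ℕ → Letter} (h : (visits w).Finite) :
    ∃ M, ∀ n, M ≤ n → quadrant (point w (n + 1)) = quadrant (point w n) := by
  by_contra! hcon
  have hinf : {n | quadrant (point w (n + 1)) ≠ quadrant (point w n)}.Infinite := by
    rw [Set.infinite_iff_exists_gt]
    intro a
    obtain ⟨n, h1, h2⟩ := hcon (a + 1)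
    exact ⟨n, h2, h1⟩
  have himg : ((fun n => n + 1) '' {n | quadrant (point w (n + 1)) ≠ quadrant (point w n)}) ⊆
      Prod.fst '' visits w := by
    rintro _ ⟨n, hn, rfl⟩
    -- A further change of quadrant must follow, so the block that starts at `n + 1` is finite and
    -- hence a visit.
    have hex : ∃ k, 0 < k ∧ quadrant (point w (n + 1 + k)) ≠ quadrant (point w (n + 1)) := by
      by_contra! hall
      obtain ⟨m, h1, h2⟩ := hcon (n + 2)
      apply h2
      have a := hall (m - n) (by omega)
      have b := hall (m - n - 1) (by omega)
      rw [show n + 1 + (m - n) = m + 1 by omega] at a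
      rw [show n + 1 + (m - n - 1) = m by omega] at b
      rw [a, b]
    classical
    obtain ⟨hk0, hk⟩ := Nat.find_spec hex
    refine ⟨(n + 1, Nat.find hex), ⟨quadrant (point w (n + 1)), hk0, ?_, ?_, hk⟩, rfl⟩
    · intro j hj1 hj2
      rcases hj1.eq_or_lt with rfl | hlt
      · rfl
      · have := Nat.find_min hex (m := j - (n + 1)) (by dsimp at hj2; omega)
        by_contra hne
        exact this ⟨by omega, by rwa [show n + 1 + (j - (n + 1)) = j by omega]⟩
    · intro j hj
      have : j = n := by dsimp at hj; omega
      subst this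
      exact fun h => hn h.symm
  exact (hinf.image (add_left_injective 1).injOn) ((h.image _).subset himg)

theorem exists_isOscillation {w : ℕ → Letter} (hw : IsPinWord w) (h : (visits w).Finite) :
    ∃ M p sx sy, IsOscillation w M p sx sy := by
  obtain ⟨M, hM⟩ := eventually_quadrant_const h
  -- The quadrant of a pin lies between its two directions. Successive pins share the direction of
  -- the earlier one, so in a common quadrant the other directions agree too.
  have key : ∀ n, M ≤ n → (w (n + 1)).dir = (w n).prev := by
    intro n hn
    have h1 := hM n hn
    have h2 := hw n
    unfold quadrant point at h1
    generalize w (n + 1) = b at *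
    generalize w n = a at *
    cases a <;> cases b <;> simp [Letter.dir, Letter.prev, Dir.vec] at h1 h2 ⊢ <;>
      split_ifs at h1 <;> omega
  have hpt : ∀ k, (w (M + k)).dir = (if k % 2 = 0 then (w M).dir else (w M).prev) ∧
      (w (M + k)).prev = if k % 2 = 0 then (w M).prev else (w M).dir := by
    intro k
    induction k with
    | zero => simp
    | succ k ih =>
      rw [← add_assoc, key (M + k) (by omega), hw (M + k), ih.1, ih.2]
      by_cases hk : k % 2 = 0
      · simp [hk, show (k + 1) % 2 ≠ 0 by omega]
      · simp [hk, show (k + 1) % 2 = 0 by omega]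
  have hpt' : ∀ n, M ≤ n →
      (n % 2 = M % 2 → (w n).dir = (w M).dir ∧ (w n).prev = (w M).prev) ∧
      (n % 2 ≠ M % 2 → (w n).dir = (w M).prev ∧ (w n).prev = (w M).dir) := by
    intro n hn
    obtain ⟨h1, h2⟩ := hpt (n - M)
    rw [show M + (n - M) = n by omega] at h1 h2
    rw [h1, h2]
    constructor
    · intro hp
      simp [show (n - M) % 2 = 0 by omega]
    · intro hp
      simp [show (n - M) % 2 ≠ 0 by omega]
  have hcases : ∀ n, M ≤ n →
      n % 2 = M % 2 ∧ (w n).dir = (w M).dir ∧ (w n).prev = (w M).prev ∨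
      n % 2 = (M + 1) % 2 ∧ (w n).dir = (w M).prev ∧ (w n).prev = (w M).dir := by
    intro n hn
    obtain ⟨h1, h2⟩ := hpt' n hn
    by_cases hp : n % 2 = M % 2
    · exact Or.inl ⟨hp, h1 hp⟩
    · exact Or.inr ⟨by omega, h2 hp⟩
  -- `p` is the parity of the horizontal pins. One of the two directions is horizontal and the other
  -- vertical, so each sum of components is a sign.
  refine ⟨M, if (w M).dir.vec.2 = 0 then M % 2 else (M + 1) % 2,
    (w M).dir.vec.1 + (w M).prev.vec.1, (w M).dir.vec.2 + (w M).prev.vec.2, ?_, ?_, ?_, ?_, ?_⟩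
  · split_ifs <;> omega
  · cases w M <;> simp [Letter.dir, Letter.prev, Dir.vec]
  · cases w M <;> simp [Letter.dir, Letter.prev, Dir.vec]
  all_goals
    intro n hn hp
    have h1 := hcases n hn
    unfold point
    generalize w M = a at *
    generalize (w n).dir = dn at *
    generalize (w n).prev = dp at *
    rcases h1 with ⟨h0, rfl, rfl⟩ | ⟨h0, rfl, rfl⟩ <;> cases a <;>
      simp [Letter.dir, Letter.prev, Dir.vec] at hp ⊢ <;> omega

theorem abs_point_le (w : ℕ → Letter) (n : ℕ) {s : ℤ} (hs : s = 1 ∨ s = -1) :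
    s * (point w n).1 ≤ 2 * n + 4 ∧ s * (point w n).2 ≤ 2 * n + 4 := by
  have h1 := coord_le w n .l
  have h2 := coord_le w n .r
  have h3 := coord_le w n .u
  have h4 := coord_le w n .d
  simp only [coord, Dir.vec] at h1 h2 h3 h4
  rcases hs with rfl | rfl <;> constructor <;> linarith

/-! ### Relative order in the oscillation -/

variable {w : ℕ → Letter} {M p : ℕ} {sx sy : ℤ}

theorem IsOscillation.sameOrder_iff (h : IsOscillation w M p sx sy) {ι : Type*} {f g : ι → ℕ} :
    SameOrder w f g ↔
      (∀ i j, sx * (point w (f i)).1 < sx * (point w (f j)).1 ↔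
        sx * (point w (g i)).1 < sx * (point w (g j)).1) ∧
      ∀ i j, sy * (point w (f i)).2 < sy * (point w (f j)).2 ↔
        sy * (point w (g i)).2 < sy * (point w (g j)).2 := by
  unfold SameOrder
  rw [sign_lt_iff (a := fun i => (point w (f i)).1) h.sx_eq,
    sign_lt_iff (a := fun i => (point w (f i)).2) h.sy_eq]

theorem IsOscillation.cases (h : IsOscillation w M p sx sy) {n : ℕ} (hn : M ≤ n) :
    n % 2 = p ∧ sx * (point w n).1 = 2 * n + 4 ∧ sy * (point w n).2 = 2 * n + 1 ∨
      n % 2 ≠ p ∧ sx * (point w n).1 = 2 * n + 1 ∧ sy * (point w n).2 = 2 * n + 4 := by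
  by_cases hp : n % 2 = p
  · exact Or.inl ⟨hp, h.horizontal n hn hp⟩
  · exact Or.inr ⟨hp, h.vertical n hn hp⟩

/-- The moves of a pair that keep its relative order: none; a common shift that keeps parities; any
move that leaves the pair at distance at least 2, since the later point then dominates the earlier
in both coordinates (even an earlier one outside the tail); and exchanging the neighbour above `a`
for the one below, as both lie on the same side of `a` in each coordinate. -/
theorem IsOscillation.lt_iff_lt (h : IsOscillation w M p sx sy) {a b a' b' : ℕ}
    (ha : a' = a ∨ M ≤ a ∧ M ≤ a') (hb : b' = b ∨ M ≤ b ∧ M ≤ b')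
    (hab : a' = a ∧ b' = b ∨
      a' + b = a + b' ∧ a % 2 = a' % 2 ∧ b % 2 = b' % 2 ∧ M ≤ a ∧ a ≤ b ∨
      a + 2 ≤ b ∧ a' + 2 ≤ b' ∧ M ≤ b ∨
      b = a + 1 ∧ a' = a ∧ b' + 1 = a ∧ M ≤ a) :
    ((sx * (point w a).1 < sx * (point w b).1 ↔ sx * (point w a').1 < sx * (point w b').1) ∧
      (sy * (point w a).2 < sy * (point w b).2 ↔ sy * (point w a').2 < sy * (point w b').2)) ∧
    (sx * (point w b).1 < sx * (point w a).1 ↔ sx * (point w b').1 < sx * (point w a').1) ∧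
      (sy * (point w b).2 < sy * (point w a).2 ↔ sy * (point w b').2 < sy * (point w a').2) := by
  rcases hab with ⟨rfl, rfl⟩ | hab
  · simp
  have hMb : M ≤ b := by omega
  have hMb' : M ≤ b' := by omega
  have hp := h.p_lt
  have h1 := h.cases hMb
  have h2 := h.cases hMb'
  have h3 := (abs_point_le w a h.sx_eq).1
  have h4 := (abs_point_le w a h.sy_eq).2
  have h5 := (abs_point_le w a' h.sx_eq).1
  have h6 := (abs_point_le w a' h.sy_eq).2
  have h7 : M ≤ a → _ := fun ha => h.cases ha
  have h8 : M ≤ a' → _ := fun ha => h.cases ha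
  generalize sx * (point w a).1 = xa at *
  generalize sy * (point w a).2 = ya at *
  generalize sx * (point w b).1 = xb at *
  generalize sy * (point w b).2 = yb at *
  generalize sx * (point w a').1 = xa' at *
  generalize sy * (point w a').2 = ya' at *
  generalize sx * (point w b').1 = xb' at *
  generalize sy * (point w b').2 = yb' at *
  clear h
  rcases hab with hab | hab | hab
  · have h9 := h7 (by omega)
    have h10 := h8 (by omega)
    clear h3 h4 h5 h6 h7 h8
    rcases h1 with h1 | h1 <;> rcases h9 with h9 | h9 <;> omega
  · clear h7 h8
    refine ⟨⟨?_, ?_⟩, ?_, ?_⟩ <;> omega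
  · have h9 := h7 (by omega)
    have h10 := h8 (by omega)
    clear h3 h4 h5 h6 h7 h8
    rcases h1 with h1 | h1 <;> rcases h9 with h9 | h9 <;> rcases h10 with h10 | h10 <;> omega

theorem IsOscillation.sameOrder_comp (h : IsOscillation w M p sx sy) {ι : Type*} {f : ι → ℕ}
    {ψ : ℕ → ℕ} (hψ : ∀ i, ψ (f i) = f i ∨ M ≤ f i ∧ M ≤ ψ (f i))
    (hpair : ∀ i j, f i < f j → ψ (f i) = f i ∧ ψ (f j) = f j ∨
      ψ (f i) + f j = f i + ψ (f j) ∧ f i % 2 = ψ (f i) % 2 ∧ f j % 2 = ψ (f j) % 2 ∧ M ≤ f i ∧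
        f i ≤ f j ∨
      f i + 2 ≤ f j ∧ ψ (f i) + 2 ≤ ψ (f j) ∧ M ≤ f j ∨
      f j = f i + 1 ∧ ψ (f i) = f i ∧ ψ (f j) + 1 = f i ∧ M ≤ f i) :
    SameOrder w f (ψ ∘ f) := by
  rw [h.sameOrder_iff]
  have key : ∀ i j, f i < f j → _ := fun i j hij => h.lt_iff_lt (hψ i) (hψ j) (hpair i j hij)
  constructor
  · intro i j
    rcases lt_trichotomy (f i) (f j) with hij | hij | hij
    · exact (key i j hij).1.1
    · simp [hij]
    · exact (key j i hij).2.1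
  · intro i j
    rcases lt_trichotomy (f i) (f j) with hij | hij | hij
    · exact (key i j hij).1.2
    · simp [hij]
    · exact (key j i hij).2.2

theorem IsOscillation.far_iff (h : IsOscillation w M p sx sy) {a b : ℕ} (ha : M ≤ a) (hb : M ≤ b) :
    a + 2 ≤ b ↔ sx * (point w a).1 < sx * (point w b).1 ∧ sy * (point w a).2 < sy * (point w b).2 := by
  have hp := h.p_lt
  have h1 := h.cases ha
  have h2 := h.cases hb
  generalize sx * (point w a).1 = xa at *
  generalize sy * (point w a).2 = ya at *
  generalize sx * (point w b).1 = xb at *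
  generalize sy * (point w b).2 = yb at *
  omega

/-- Up to reflection, the lower right point of an inversion is the horizontal pin. So the order
shows the parities of adjacent indices. -/
theorem IsOscillation.near_iff (h : IsOscillation w M p sx sy) {a b : ℕ} (ha : M ≤ a) (hb : M ≤ b) :
    ((a = b + 1 ∨ b = a + 1) ∧ a % 2 = p) ↔
      sx * (point w b).1 < sx * (point w a).1 ∧ sy * (point w a).2 < sy * (point w b).2 := by
  have hp := h.p_lt
  have h1 := h.cases ha
  have h2 := h.cases hb
  generalize sx * (point w a).1 = xa at *
  generalize sy * (point w a).2 = ya at *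
  generalize sx * (point w b).1 = xb at *
  generalize sy * (point w b).2 = yb at *
  omega

/-! ### Recovering the indices from the order -/

/-- Two step-restricted sequences with the same start are equal if they have the same
far pairs and the same parities at adjacent pairs. -/
theorem eq_of_stepRestricted {ι : Type*} {f g : ι → ℕ} {s : ℕ} {A B : Finset ℕ} (hs : 4 ≤ s)
    (hf : Function.Injective f) (hg : Function.Injective g)
    (hA : ∀ a, a ∈ A ↔ ∃ i, f i = a) (hB : ∀ a, a ∈ B ↔ ∃ i, g i = a)
    (hAs : StepRestricted (s + 1) A) (hBs : StepRestricted (s + 1) B)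
    (hsA : s ∈ A) (hsB : s ∈ B) (hAle : ∀ a ∈ A, s ≤ a) (hBle : ∀ b ∈ B, s ≤ b)
    (hfar : ∀ i j, f i + 2 ≤ f j ↔ g i + 2 ≤ g j)
    (hpar : ∀ i j, f i = f j + 1 → f i % 2 = g i % 2 ∧ f j % 2 = g j % 2)
    (hpar' : ∀ i j, g i = g j + 1 → f i % 2 = g i % 2 ∧ f j % 2 = g j % 2) :
    f = g := by
  suffices h : ∀ m i, f i = m ∨ g i = m → f i = g i from funext fun i => h _ i (Or.inl rfl)
  intro m
  induction m using Nat.strong_induction_on generalizing f g A B with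
  | _ m ih =>
  -- Only half of the induction step is needed; the other half exchanges `f` and `g`.
  suffices step : ∀ (f g : ι → ℕ) (A B : Finset ℕ), Function.Injective f → Function.Injective g →
      (∀ a, a ∈ A ↔ ∃ i, f i = a) → (∀ a, a ∈ B ↔ ∃ i, g i = a) →
      StepRestricted (s + 1) A → StepRestricted (s + 1) B →
      s ∈ B → (∀ a ∈ A, s ≤ a) → (∀ b ∈ B, s ≤ b) →
      (∀ i j, f i + 2 ≤ f j ↔ g i + 2 ≤ g j) →
      (∀ i j, f i = f j + 1 → f i % 2 = g i % 2 ∧ f j % 2 = g j % 2) →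
      (∀ k < m, ∀ i, f i = k ∨ g i = k → f i = g i) → ∀ i, f i = m → f i = g i by
    have ih' : ∀ k < m, ∀ i, f i = k ∨ g i = k → f i = g i := fun k hk =>
      ih k hk hf hg hA hB hAs hBs hsA hsB hAle hBle hfar hpar hpar'
    rintro i (hi | hi)
    · exact step f g A B hf hg hA hB hAs hBs hsB hAle hBle hfar hpar ih' i hi
    · refine (step g f B A hg hf hB hA hBs hAs hsA hBle hAle (fun i j => (hfar i j).symm)
        (fun i j hij => ?_) (fun k hk i hi => (ih' k hk i hi.symm).symm) i hi).symm
      have := hpar' i j hij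
      omega
  clear * - hs
  intro f g A B hf hg hA hB hAs hBs hsB hAle hBle hfar hpar ih i hi
  have hmem : ∀ k < m, k ∈ A ↔ k ∈ B := by
    intro k hk
    rw [hA, hB]
    constructor
    · rintro ⟨j, hj⟩; exact ⟨j, by rw [← ih k hk j (Or.inl hj), hj]⟩
    · rintro ⟨j, hj⟩; exact ⟨j, by rw [ih k hk j (Or.inr hj), hj]⟩
  have hge : ∀ j, m ≤ f j → m ≤ g j := by
    intro j hj
    by_contra! hlt
    have := ih _ hlt j (Or.inr rfl)
    omega
  have hge' : ∀ j, m ≤ g j → m ≤ f j := by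
    intro j hj
    by_contra! hlt
    have := ih _ hlt j (Or.inl rfl)
    omega
  have hgi := hge i hi.ge
  -- If `g j = m` with `j ≠ i`, then `f j` is above `m` but not far above it, so `f j = m + 1`. This
  -- contradicts the equal parities of adjacent pairs.
  have key : m ∈ B → f i = g i := by
    intro hm
    obtain ⟨j, hj⟩ := (hB m).1 hm
    by_cases hij : j = i
    · subst hij; omega
    have h1 := hge' j hj.ge
    have h2 : f j ≠ f i := fun h => hij (hf h)
    have h3 := hfar i j
    have h4 : f j = f i + 1 := by omega
    have := hpar j i h4
    omega
  have hmA : m ∈ A := (hA m).2 ⟨i, hi⟩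
  have hgB : g i ∈ B := (hB _).2 ⟨i, rfl⟩
  have hsm := hAle m hmA
  rcases hsm.eq_or_lt with rfl | hlt
  · exact key hsB
  by_cases h1 : m - 1 ∈ A
  · obtain ⟨j, hj⟩ := (hA _).1 h1
    have h2 := ih (m - 1) (by omega) j (Or.inl hj)
    have := hfar j i
    omega
  have h1B : m - 1 ∉ B := fun h => h1 ((hmem _ (by omega)).2 h)
  -- If `m` is not in `B`, the least element of `B` above it has neither of its two predecessors in
  -- `B`. So it ends a step 3, which starts below `m - 1` and hence at `m - 2`; two steps 1 follow.
  have hnext : m ∈ B ∨ m + 1 ∈ B ∧ m - 2 ∈ A ∧ m + 2 ∈ B ∧ m + 3 ∈ B := by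
    by_contra! hno
    have hex : ∃ c, m ≤ c ∧ c ∈ B := ⟨g i, hgi, hgB⟩
    classical
    obtain ⟨hc1, hc2⟩ := Nat.find_spec hex
    have hmin : ∀ c', c' < Nat.find hex → c' ∈ B → c' < m := fun c' h1 h2 => by
      have := Nat.find_min hex h1
      by_contra h3
      exact this ⟨by omega, h2⟩
    generalize Nat.find hex = c at *
    have hcm : c ≠ m := fun h => hno.1 (h ▸ hc2)
    obtain ⟨g1, g2⟩ := hBs c hc2 (by omega)
    have d1 : c - 1 ∉ B := fun h => by
      have := hmin _ (by omega) h
      omega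
    have d2 : c - 2 ∉ B := fun h => by
      have := hmin _ (by omega) h
      have : c - 2 = m - 1 := by omega
      exact h1B (this ▸ h)
    have d3 : c - 3 ∈ B := by tauto
    have d4 := hmin _ (by omega) d3
    have : c - 3 ≠ m - 1 := fun h => h1B (h ▸ d3)
    have hc : c = m + 1 := by omega
    subst hc
    obtain ⟨e1, e2⟩ := g2 d1 d2
    rw [show m + 1 - 3 = m - 2 by omega] at d3
    exact hno.2 hc2 ((hmem _ (by omega)).2 d3) e1 e2
  rcases hnext with hm | ⟨b1, a2, b2, b3⟩
  · exact key hm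
  by_cases hm : m ∈ B
  · exact key hm
  exfalso
  -- The values of `f` at `x`, `y`, `z` are consecutive as well and have the parities of `m + 1`, `m
  -- + 2`, `m + 3`. Hence `f y ≥ m + 2 = f i + 2`, so `g i + 2 ≤ g y = m + 2`, although `g i > m`.
  obtain ⟨x, hx⟩ := (hB _).1 b1
  obtain ⟨y, hy⟩ := (hB _).1 b2
  obtain ⟨z, hz⟩ := (hB _).1 b3
  have hxm := hge' x (by omega)
  have hym := hge' y (by omega)
  have hzm := hge' z (by omega)
  have hgm : g i ≠ m := fun h => hm (h ▸ hgB)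
  have n1 : ∀ j k, g j ≠ g k → f j ≠ f k := fun j k h h' => h (by rw [hf h'])
  have n2 : ∀ j k, f j ≠ f k → g j ≠ g k := fun j k h h' => h (by rw [hg h'])
  have xy := n1 x y (by omega)
  have yz := n1 y z (by omega)
  have xz := n1 x z (by omega)
  have ix := hfar i x
  have iy := hfar i y
  have iz := hfar i z
  have xy2 := hfar x y
  have yx2 := hfar y x
  have yz2 := hfar y z
  have zy2 := hfar z y
  have xz2 := hfar x z
  have pix := hpar x i
  have piy := hpar y i
  have pxy := hpar y x
  have pyx := hpar x y
  have pyz := hpar z y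
  have nix := n2 i x
  omega

/-! ### Embeddings and their sets of indices -/

variable {n : ℕ}

/-- `f` embeds `σ` into the gridded permutation of `w`. -/
structure IsEmbedding (σ : GriddedPerm n) (w : ℕ → Letter) (f : Fin n → ℕ) : Prop where
  fst_lt : ∀ i j, i < j ↔ (point w (f i)).1 < (point w (f j)).1
  snd_lt : ∀ i j, σ.perm i < σ.perm j ↔ (point w (f i)).2 < (point w (f j)).2
  fst_neg : ∀ i : Fin n, (i : ℕ) < σ.left ↔ (point w (f i)).1 < 0
  snd_neg : ∀ i : Fin n, (σ.perm i : ℕ) < σ.below ↔ (point w (f i)).2 < 0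

theorem contained_iff {σ : GriddedPerm n} : Contained σ w ↔ ∃ f, IsEmbedding σ w f :=
  ⟨fun ⟨f, a, b, c, d⟩ => ⟨f, a, b, c, d⟩, fun ⟨f, a, b, c, d⟩ => ⟨f, a, b, c, d⟩⟩

theorem IsEmbedding.injective {σ : GriddedPerm n} {f : Fin n → ℕ} (hf : IsEmbedding σ w f) :
    Function.Injective f := by
  intro i j hij
  by_contra hne
  rcases lt_or_gt_of_ne hne with h | h
  · rw [hf.fst_lt, hij] at h; exact lt_irrefl _ h
  · rw [hf.fst_lt, hij] at h; exact lt_irrefl _ h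

theorem IsEmbedding.sameOrder {σ : GriddedPerm n} {f g : Fin n → ℕ} (hf : IsEmbedding σ w f)
    (hg : IsEmbedding σ w g) : SameOrder w f g :=
  ⟨fun i j => (hf.fst_lt i j).symm.trans (hg.fst_lt i j),
    fun i j => (hf.snd_lt i j).symm.trans (hg.snd_lt i j)⟩

theorem IsOscillation.neg_iff (h : IsOscillation w M p sx sy) (hn : M ≤ n) :
    ((point w n).1 < 0 ↔ sx = -1) ∧ ((point w n).2 < 0 ↔ sy = -1) := by
  have h1 := h.cases hn
  rcases h.sx_eq with rfl | rfl <;> rcases h.sy_eq with rfl | rfl <;> omega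

theorem IsOscillation.isEmbedding_comp (h : IsOscillation w M p sx sy) {σ : GriddedPerm n}
    {f : Fin n → ℕ} (hf : IsEmbedding σ w f)
    {ψ : ℕ → ℕ} (hψ : ∀ i, ψ (f i) = f i ∨ M ≤ f i ∧ M ≤ ψ (f i))
    (hpair : ∀ i j, f i < f j → ψ (f i) = f i ∧ ψ (f j) = f j ∨
      ψ (f i) + f j = f i + ψ (f j) ∧ f i % 2 = ψ (f i) % 2 ∧ f j % 2 = ψ (f j) % 2 ∧ M ≤ f i ∧
        f i ≤ f j ∨
      f i + 2 ≤ f j ∧ ψ (f i) + 2 ≤ ψ (f j) ∧ M ≤ f j ∨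
      f j = f i + 1 ∧ ψ (f i) = f i ∧ ψ (f j) + 1 = f i ∧ M ≤ f i) :
    IsEmbedding σ w (ψ ∘ f) := by
  obtain ⟨h1, h2⟩ := h.sameOrder_comp hψ hpair
  refine ⟨fun i j => (hf.fst_lt i j).trans (h1 i j), fun i j => (hf.snd_lt i j).trans (h2 i j),
    fun i => (hf.fst_neg i).trans ?_, fun i => (hf.snd_neg i).trans ?_⟩
  · rcases hψ i with e | ⟨a, b⟩
    · rw [Function.comp_apply, e]
    · rw [(h.neg_iff a).1, Function.comp_apply, (h.neg_iff b).1]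
  · rcases hψ i with e | ⟨a, b⟩
    · rw [Function.comp_apply, e]
    · rw [(h.neg_iff a).2, Function.comp_apply, (h.neg_iff b).2]

/-- An embedding with the least sum of indices has a step-restricted range. -/
theorem IsOscillation.exists_stepRestricted (h : IsOscillation w M p sx sy) {σ : GriddedPerm n}
    (hσ : σ ∈ pinClass w n) :
    ∃ A ∈ stepFamily (M + 5) n, ∃ f, IsEmbedding σ w f ∧ Finset.univ.image f = A := by
  obtain ⟨f, hf, hmin⟩ := (measure fun f : Fin n → ℕ => ∑ i, f i).wf.has_min
    {f | IsEmbedding σ w f} (contained_iff.1 hσ)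
  refine ⟨_, ⟨?_, ?_⟩, f, hf, rfl⟩
  · rw [Finset.card_image_of_injective _ hf.injective, Finset.card_univ, Fintype.card_fin]
  have hdesc : ∀ ψ : ℕ → ℕ, IsEmbedding σ w (ψ ∘ f) → (∀ i, ψ (f i) ≤ f i) →
      ∀ i, ψ (f i) = f i := by
    intro ψ h1 h2 i
    by_contra h3
    exact hmin _ h1 (Finset.sum_lt_sum (fun i _ => h2 i)
      ⟨i, Finset.mem_univ i, lt_of_le_of_ne (h2 i) h3⟩)
  have hmem : ∀ {a}, a ∉ Finset.univ.image f → ∀ i, f i ≠ a := fun ha i hi =>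
    ha (Finset.mem_image.2 ⟨i, Finset.mem_univ i, hi⟩)
  intro b hb hbM
  obtain ⟨k, -, hk⟩ := Finset.mem_image.1 hb
  constructor
  · by_contra! hno
    obtain ⟨n1, n2, n3⟩ := hno
    have m1 := hmem n1
    have m2 := hmem n2
    have m3 := hmem n3
    -- A gap of at least 4 below `b`: shifting everything from `b` on down by 2 keeps parities and
    -- leaves the two parts far apart.
    have := hdesc (fun a => if b ≤ a then a - 2 else a) (h.isEmbedding_comp hf
      (fun i => by split_ifs <;> omega)
      (fun i j hij => by
        have := m1 i
        have := m2 i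
        have := m3 i
        split_ifs <;> omega))
      (fun i => by split_ifs <;> omega) k
    rw [if_pos hk.ge] at this
    omega
  · intro n1 n2
    have m1 := hmem n1
    have m2 := hmem n2
    have hb1 : b + 1 ∈ Finset.univ.image f := by
      by_contra n3
      have m3 := hmem n3
      -- Here `b` has no neighbour in the range and still has none after moving down by 1.
      have := hdesc (fun a => if a = b then b - 1 else a) (h.isEmbedding_comp hf
        (fun i => by split_ifs <;> omega)
        (fun i j hij => by
          have := m1 i
          have := m2 i
          have := m3 j
          split_ifs <;> omega))
        (fun i => by split_ifs <;> omega) k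
      rw [if_pos hk] at this
      omega
    refine ⟨hb1, ?_⟩
    by_contra n3
    have m3 := hmem n3
    obtain ⟨l, -, hl⟩ := Finset.mem_image.1 hb1
    -- Here `b` and `b + 1` are isolated from the rest, so the upper neighbour of `b` can be
    -- replaced by the lower one.
    have := hdesc (fun a => if a = b + 1 then b - 1 else a) (h.isEmbedding_comp hf
      (fun i => by split_ifs <;> omega)
      (fun i j hij => by
        have := m1 i
        have := m2 i
        have := m3 j
        split_ifs <;> omega))
      (fun i => by split_ifs <;> omega) l
    rw [if_pos hl] at this
    omega

theorem perm_eq_of_lt_iff {σ τ : Equiv.Perm (Fin n)} (h : ∀ i j, σ i < σ j ↔ τ i < τ j) :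
    σ = τ := by
  have hmono : StrictMono (σ.symm.trans τ) := fun a b hab => by
    have := h (σ.symm a) (σ.symm b)
    simp only [Equiv.apply_symm_apply] at this
    exact this.1 hab
  have := hmono.range_inj (g := (id : Fin n → Fin n)) strictMono_id
  rw [Equiv.range_eq_univ, Set.range_id] at this
  have hid := this.1 rfl
  ext i
  have := congrFun hid (σ i)
  simp only [Equiv.trans_apply, Equiv.symm_apply_apply, id] at this
  rw [this]

theorem fin_eq_of_lt_iff {a b : Fin (n + 1)} (h : ∀ i : Fin n, (i : ℕ) < a ↔ (i : ℕ) < b) :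
    a = b := by
  by_contra hne
  rcases lt_or_gt_of_ne (Fin.val_ne_of_ne hne) with hlt | hlt
  · have := h ⟨a, by omega⟩
    simp at this
    omega
  · have := h ⟨b, by omega⟩
    simp at this
    omega

/-- An embedding lists its range by increasing first coordinate, so the range determines the
embedding, which in turn determines the permutation and both lines. -/
theorem IsEmbedding.eq_of_image_eq {σ τ : GriddedPerm n} {f g : Fin n → ℕ}
    (hf : IsEmbedding σ w f) (hg : IsEmbedding τ w g)
    (h : Finset.univ.image f = Finset.univ.image g) : σ = τ := by
  have hfm : StrictMono fun i => (point w (f i)).1 := fun i j hij => (hf.fst_lt i j).1 hij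
  have hgm : StrictMono fun i => (point w (g i)).1 := fun i j hij => (hg.fst_lt i j).1 hij
  have hmem : ∀ a, (∃ i, f i = a) ↔ ∃ i, g i = a := by
    intro a
    have : a ∈ Finset.univ.image f ↔ a ∈ Finset.univ.image g := by rw [h]
    simpa using this
  have hrange : (Set.range fun i => (point w (f i)).1) = Set.range fun i => (point w (g i)).1 := by
    ext x
    constructor
    · rintro ⟨i, rfl⟩
      obtain ⟨j, hj⟩ := (hmem _).1 ⟨i, rfl⟩
      exact ⟨j, by dsimp only; rw [hj]⟩
    · rintro ⟨i, rfl⟩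
      obtain ⟨j, hj⟩ := (hmem _).2 ⟨i, rfl⟩
      exact ⟨j, by dsimp only; rw [hj]⟩
  have hx := (hfm.range_inj hgm).1 hrange
  have hfg : f = g := by
    funext i
    obtain ⟨j, hj⟩ := (hmem _).1 ⟨i, rfl⟩
    have h1 := congrFun hx i
    rw [← hj] at h1
    rw [← hj, hgm.injective h1]
  subst hfg
  have hperm : σ.perm = τ.perm :=
    perm_eq_of_lt_iff fun i j => (hf.snd_lt i j).trans (hg.snd_lt i j).symm
  refine GriddedPerm.ext hperm
    (fin_eq_of_lt_iff fun i => (hf.fst_neg i).trans (hg.fst_neg i).symm)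
    (fin_eq_of_lt_iff fun i => ?_)
  have h1 := hf.snd_neg (σ.perm.symm i)
  have h2 := hg.snd_neg (σ.perm.symm i)
  rw [← hperm] at h2
  rw [Equiv.apply_symm_apply] at h1 h2
  exact h1.trans h2.symm

theorem exists_equiv_strictMono {A : Finset ℕ} (hA : A.card = n) {x : ℕ → ℤ}
    (hx : Set.InjOn x A) : ∃ e : Fin n ≃ A, StrictMono fun i => x (e i) := by
  let L : LinearOrder A := LinearOrder.lift' (fun a : A => x a) fun a b hab =>
    Subtype.ext (hx a.2 b.2 hab)
  let e := @Fintype.orderIsoFinOfCardEq A L _ n (by simpa using hA)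
  exact ⟨e.toEquiv, fun i j hij => (@OrderIso.lt_iff_lt _ _ _ L.toPreorder e i j).2 hij⟩

theorem IsOscillation.exists_isEmbedding (h : IsOscillation w M p sx sy) {A : Finset ℕ}
    (hc : A.card = n) (hA : ∀ a ∈ A, M ≤ a) :
    ∃ (σ : GriddedPerm n) (f : Fin n → ℕ), IsEmbedding σ w f ∧ Finset.univ.image f = A := by
  have hinj : ∀ a ∈ A, ∀ b ∈ A, a ≠ b →
      (point w a).1 ≠ (point w b).1 ∧ (point w a).2 ≠ (point w b).2 := by
    intro a ha b hb hab
    have hp := h.p_lt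
    have h1 := h.cases (hA a ha)
    have h2 := h.cases (hA b hb)
    constructor
    · intro he; rw [he] at h1; omega
    · intro he; rw [he] at h1; omega
  obtain ⟨e, he⟩ := exists_equiv_strictMono hc (x := fun a => (point w a).1)
    fun a ha b hb hab => by_contra fun hne => (hinj a ha b hb hne).1 hab
  obtain ⟨e', he'⟩ := exists_equiv_strictMono hc (x := fun a => (point w a).2)
    fun a ha b hb hab => by_contra fun hne => (hinj a ha b hb hne).2 hab
  -- `e` and `e'` sort `A` by the two coordinates. All points lie in one quadrant, so each line has
  -- all of them on one side.
  refine ⟨⟨e.trans e'.symm, if sx = -1 then Fin.last n else 0, if sy = -1 then Fin.last n else 0⟩,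
    fun i => e i, ⟨fun i j => he.lt_iff_lt.symm, fun i j => ?_, fun i => ?_, fun i => ?_⟩, ?_⟩
  · rw [← he'.lt_iff_lt]
    simp
  · rw [(h.neg_iff (hA _ (e i).2)).1]
    by_cases hs : sx = -1 <;> simp [hs]
  · rw [(h.neg_iff (hA _ (e i).2)).2]
    by_cases hs : sy = -1 <;> simp [hs]
  · ext a
    simp only [Finset.mem_image, Finset.mem_univ, true_and]
    constructor
    · rintro ⟨i, rfl⟩; exact (e i).2
    · intro ha; exact ⟨e.symm ⟨a, ha⟩, by simp⟩

theorem IsOscillation.eq_of_isEmbedding (h : IsOscillation w M p sx sy) {s : ℕ} (hs : 4 ≤ s)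
    (hMs : M ≤ s) {σ : GriddedPerm n} {f g : Fin n → ℕ}
    (hf : IsEmbedding σ w f) (hg : IsEmbedding σ w g)
    (hA : Finset.univ.image f ∈ stepFamilyFrom s n)
    (hB : Finset.univ.image g ∈ stepFamilyFrom s n) : f = g := by
  obtain ⟨h1, h2⟩ := h.sameOrder_iff.1 (hf.sameOrder hg)
  have hfM : ∀ i, M ≤ f i := fun i => hMs.trans (hA.2.2 _ (by simp))
  have hgM : ∀ i, M ≤ g i := fun i => hMs.trans (hB.2.2 _ (by simp))
  have hnear : ∀ i j, ((f i = f j + 1 ∨ f j = f i + 1) ∧ f i % 2 = p) ↔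
      ((g i = g j + 1 ∨ g j = g i + 1) ∧ g i % 2 = p) := fun i j => by
    rw [h.near_iff (hfM i) (hfM j), h.near_iff (hgM i) (hgM j), h1, h2]
  have hp := h.p_lt
  refine eq_of_stepRestricted hs hf.injective hg.injective (by simp) (by simp) hA.1.2 hB.1.2
    hA.2.1 hB.2.1 hA.2.2 hB.2.2 (fun i j => ?_) (fun i j hij => ?_) (fun i j hij => ?_)
  · rw [h.far_iff (hfM i) (hfM j), h.far_iff (hgM i) (hgM j), h1, h2]
  · have := hnear i j
    have := hnear j i
    omega
  · have := hnear i j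
    have := hnear j i
    omega

/-! ### Bounds for the class and the growth rate -/

theorem IsOscillation.ncard_pinClass_le (h : IsOscillation w M p sx sy) (n : ℕ) :
    (pinClass w n).ncard ≤ (stepFamily (M + 5) n).ncard := by
  choose! F hF f hf hfF using fun σ (hσ : σ ∈ pinClass w n) => h.exists_stepRestricted hσ
  refine Set.ncard_le_ncard_of_injOn F hF ?_ (stepFamily_finite (by omega) n)
  intro σ hσ τ hτ hστ
  exact (hf σ hσ).eq_of_image_eq (hf τ hτ) (by rw [hfF σ hσ, hfF τ hτ, hστ])

theorem IsOscillation.le_ncard_pinClass (h : IsOscillation w M p sx sy) (n : ℕ) :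
    (stepFamilyFrom (M + 4) n).ncard ≤ (pinClass w n).ncard := by
  have hex : ∀ A ∈ stepFamilyFrom (M + 4) n, ∃ σ : GriddedPerm n,
      ∃ f, IsEmbedding σ w f ∧ Finset.univ.image f = A := fun A hA =>
    h.exists_isEmbedding hA.1.1 fun a ha => (Nat.le_add_right M 4).trans (hA.2.2 a ha)
  have : Nonempty (GriddedPerm n) := ⟨⟨1, 0, 0⟩⟩
  choose! F f hf hfF using hex
  refine Set.ncard_le_ncard_of_injOn F (fun A hA => contained_iff.2 ⟨_, hf A hA⟩) ?_
    (Set.toFinite _)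
  intro A hA B hB hAB
  have hB' := hf B hB
  rw [← hAB] at hB'
  rw [← hfF A hA, ← hfF B hB, h.eq_of_isEmbedding (by omega) (Nat.le_add_right M 4) (hf A hA) hB'
    ((hfF A hA).symm ▸ hA) ((hfF B hB).symm ▸ hB)]

theorem hasGrowthRate_pinClass {κ : ℝ} (hκ : 2 ≤ κ) (hroot : κ ^ 3 = 2 * κ ^ 2 + 1)
    (hw : IsPinWord w) (hfin : (visits w).Finite) :
    HasGrowthRate (fun n => (pinClass w n).ncard) κ := by
  obtain ⟨M, p, sx, sy, h⟩ := exists_isOscillation hw hfin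
  have hκ0 : 0 < κ := by linarith
  refine hasGrowthRate_of_le_of_le hκ0 (c := (κ ^ 3)⁻¹) (C := 11 * 2 ^ (M + 5)) (by positivity)
    (by positivity) (fun n hn => ?_) (fun n _ => ?_)
  · obtain ⟨k, rfl⟩ := Nat.exists_eq_add_of_lt hn
    rw [zero_add, inv_mul_le_iff₀ (by positivity)]
    refine (pow_le_ncard_stepFamilyFrom (s := M + 4) (by omega) hκ hroot k).trans ?_
    gcongr
    exact h.le_ncard_pinClass _
  · refine le_trans ?_ (ncard_stepFamily_le_pow (K := M + 5) (by omega) hκ hroot n)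
    exact_mod_cast h.ncard_pinClass_le n

end PinClass

theorem theorem3p7 :
    ∃ κ : ℝ, IsGreatest {z : ℝ | z ^ 3 - 2 * z ^ 2 - 1 = 0} κ ∧
      |κ - 2.20557| < 0.000005 ∧
      ∀ w : ℕ → PinClass.Letter, PinClass.IsPinWord w → (PinClass.visits w).Finite →
        PinClass.HasGrowthRate (fun n => (PinClass.pinClass w n).ncard) κ := by
  obtain ⟨κ, hκ, habs⟩ := PinClass.exists_greatest_root
  refine ⟨κ, hκ, habs, fun w hw hfin => PinClass.hasGrowthRate_pinClass ?_ ?_ hw hfin⟩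
  · rw [abs_lt] at habs
    linarith
  · have : κ ^ 3 - 2 * κ ^ 2 - 1 = 0 := hκ.1
    linarith
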